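/- Throughout, Hilbert spaces are complex. An operator $a$ in a Hilbert space $\mathfrak H$ (with domain $\mathrm{dom}\,a$ a linear subspace, not necessarily dense) is positive symmetric if $(ax,y)=(x,ay)$ and $(ax,x)\ge 0$ for all $x,y\in\mathrm{dom}\,a$. Let $\mathfrak H_a$ be the completion of $\mathrm{ran}\,a$ under the inner product $\langle ax,ay\rangle=(ax,y)$. Put $J_a:\mathfrak H_a\to\mathfrak H$, $\mathrm{dom}\,J_a=\mathrm{ran}\,a$, $J_a(ax)=ax$; $Q_a:\mathfrak H\to\mathfrak H_a$, $\mathrm{dom}\,Q_a=\mathrm{dom}\,a$, $Q_ax=ax$; and, for a second positive symmetric operator $b$, $J:\mathfrak H_a\oplus\mathfrak H_b\to\mathfrak H$, $\mathrm{dom}\,J=\mathrm{ran}\,a\oplus\mathrm{ran}\,b$, $J(ax\oplus by)=ax+by$. The Krein--von Neumann extension is $a_{\mathsf K}=J_a^{**}J_a^*$, the Friedrichs extension is $a_{\mathsf F}=Q_a^*Q_a^{**}$ (for densely defined $a$), and the form sum is $a\stackrel{.}{+}b=J^{**}J^*$ (if the form domains of $a$ and $b$, i.e. the sets $\{y:\exists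 m\ \forall x\in\mathrm{dom}\,a\ |(ax,y)|^2\le m(ax,x)\}$ and likewise for $b$, have a dense intersection). Operator sums $A+B$ are taken on $\mathrm{dom}\,A\cap\mathrm{dom}\,B$. For positive selfadjoint operators, $A\le B$ means $\mathrm{dom}\,B^{1/2}\subseteq\mathrm{dom}\,A^{1/2}$ and $\|A^{1/2}y\|\le\|B^{1/2}y\|$ for all $y\in\mathrm{dom}\,B^{1/2}$. (1) Let $a$ be a densely defined, closed, symmetric operator in a Hilbert space $\mathfrak H$ with positive lower bound (there is $c>0$ with $(ax,x)\ge c\|x\|^2$ for all $x\in\mathrm{dom}\,a$), and suppose that $a$ is not selfadjoint. Then $\dim\ker a^*>0$; $a$ has infinitely many selfadjoint extensions, and all of them are restrictions of $a^*$; $a_{\mathsf K}$ and $a_{\mathsf F}$ are positive selfadjoint extensions of $a$, and $a_{\mathsf K}\le T\le a_{\mathsf F}$ for every positive selfadjoint extension $T$ of $a$; $\mathrm{dom}\,a_{\mathsf K}\cap\mathrm{dom}\,a_{\mathsf F}$ is dense in $\mathfrak H$; and $$a_{\mathsf K}\stackrel{.}{+}a_{\mathsf F}=2a_{\mathsf F},\qquad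 (a_{\mathsf K}+a_{\mathsf F})_{\mathsf K}=2a_{\mathsf K},\qquad a_{\mathsf K}\stackrel{.}{+}a_{\mathsf F}\neq(a_{\mathsf K}+a_{\mathsf F})_{\mathsf K}.$$ (2) Hence in general $A\stackrel{.}{+}B\ne(A+B)_{\mathsf K}$ even when $\mathrm{dom}\,A\cap\mathrm{dom}\,B$ is dense: there are a Hilbert space and positive selfadjoint operators $A,B$ in it such that $\mathrm{dom}\,A\cap\mathrm{dom}\,B$ is dense and $A\stackrel{.}{+}B\neq(A+B)_{\mathsf K}$. -/

import Mathlib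

noncomputable section

namespace FormSum

section Basic

variable {E F G : Type*}
  [NormedAddCommGroup E] [InnerProductSpace ℂ E]
  [NormedAddCommGroup F] [InnerProductSpace ℂ F]
  [NormedAddCommGroup G] [InnerProductSpace ℂ G]

/-- Positive symmetric operators; the domain need not be dense. -/
structure IsPosSymm (a : E →ₗ.[ℂ] E) : Prop where
  symm : a.IsFormalAdjoint a
  nonneg : ∀ x : a.domain, 0 ≤ (inner ℂ (a x) (x : E)).re

/-- The product `g f` of unbounded operators, on its natural domain
`{x ∈ dom f | f x ∈ dom g}`. -/
def opMul (g : F →ₗ.[ℂ] G) (f : E →ₗ.[ℂ] F) : E →ₗ.[ℂ] G where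
  domain := (g.domain.comap f.toFun).map f.domain.subtype
  toFun :=
    { toFun := fun x => g
        ⟨f ⟨(x : E), by obtain ⟨_, y, _, rfl⟩ := x; exact y.2⟩,
          by obtain ⟨_, y, hy, rfl⟩ := x; exact hy⟩
      map_add' := fun x y => by
        rw [← g.map_add]; congr 1; ext; exact f.map_add ⟨x, _⟩ ⟨y, _⟩
      map_smul' := fun c x => by
        rw [RingHom.id_apply, ← g.map_smul]; congr 1; ext; exact f.map_smul c ⟨x, _⟩ }

theorem opMul_apply_mem (g : F →ₗ.[ℂ] G) (f : E →ₗ.[ℂ] F) (x : (opMul g f).domain) :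
    ∃ (h : (x : E) ∈ f.domain) (h' : f ⟨x, h⟩ ∈ g.domain), opMul g f x = g ⟨f ⟨x, h⟩, h'⟩ :=
  ⟨_, _, rfl⟩

theorem IsPosSymm.add {a b : E →ₗ.[ℂ] E} (ha : IsPosSymm a) (hb : IsPosSymm b) :
    IsPosSymm (a + b) where
  symm x y := by
    rw [LinearPMap.add_apply, LinearPMap.add_apply, inner_add_left, inner_add_right]
    exact congrArg₂ (· + ·) (ha.symm ⟨x, x.2.1⟩ ⟨y, y.2.1⟩) (hb.symm ⟨x, x.2.2⟩ ⟨y, y.2.2⟩)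
  nonneg x := by
    rw [LinearPMap.add_apply, inner_add_left, Complex.add_re]
    exact add_nonneg (ha.nonneg ⟨x, x.2.1⟩) (hb.nonneg ⟨x, x.2.2⟩)

theorem isPosSymm_of_repr {a : E →ₗ.[ℂ] E} (R : a.domain → F)
    (h : ∀ x y : a.domain, inner ℂ (a x) (y : E) = inner ℂ (R x) (R y)) : IsPosSymm a where
  symm x y := by
    rw [h, ← inner_conj_symm (x : E), h, inner_conj_symm]
  nonneg x := by
    rw [h]; exact inner_self_nonneg (𝕜 := ℂ)

theorem isPosSymm_adjoint_mul_self [CompleteSpace E] (S : E →ₗ.[ℂ] F) :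
    IsPosSymm (opMul S.adjoint S) := by
  by_cases hS : Dense (S.domain : Set E)
  · refine isPosSymm_of_repr (fun x => S ⟨x, (opMul_apply_mem _ _ x).1⟩) fun x y => ?_
    obtain ⟨h, h', e⟩ := opMul_apply_mem _ _ x
    refine (congrArg (fun z => inner ℂ z (y : E)) e).trans ?_
    exact LinearPMap.adjoint_isFormalAdjoint hS ⟨_, h'⟩ ⟨y, (opMul_apply_mem _ _ y).1⟩
  · refine isPosSymm_of_repr (fun _ => (0 : E)) fun x y => ?_
    obtain ⟨h, h', e⟩ := opMul_apply_mem _ _ x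
    rw [e, LinearPMap.adjoint_apply_of_not_dense hS]; simp

theorem isPosSymm_self_mul_adjoint [CompleteSpace E] (S : E →ₗ.[ℂ] F) :
    IsPosSymm (opMul S S.adjoint) := by
  by_cases hS : Dense (S.domain : Set E)
  · refine isPosSymm_of_repr (fun x => S.adjoint ⟨x, (opMul_apply_mem _ _ x).1⟩) fun x y => ?_
    obtain ⟨h, h', e⟩ := opMul_apply_mem _ _ x
    refine (congrArg (fun z => inner ℂ z (y : F)) e).trans ?_
    exact (LinearPMap.adjoint_isFormalAdjoint hS).symm ⟨_, h'⟩ ⟨y, (opMul_apply_mem _ _ y).1⟩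
  · refine isPosSymm_of_repr (fun _ => (0 : E)) fun x y => ?_
    obtain ⟨h, h', e⟩ := opMul_apply_mem _ _ x
    have : (⟨S.adjoint ⟨x, h⟩, h'⟩ : S.domain) = 0 :=
      Subtype.ext (LinearPMap.adjoint_apply_of_not_dense hS _)
    rw [e, this, S.map_zero]; simp

/-- `m` is an admissible constant for `y` in the definition of the form domain of `a`: the form
domain of `a` consists of the `y` with such an `m ≥ 0`. If `a` is positive and selfadjoint, the form
domain is `dom a^{1/2}`, and the least such `m ≥ 0` is `‖a^{1/2} y‖²`. -/
def FormBound (a : E →ₗ.[ℂ] E) (y : E) (m : ℝ) : Prop :=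
  ∀ x : a.domain, ‖inner ℂ (a x) y‖ ^ 2 ≤ m * (inner ℂ (a x) (x : E)).re

/-- The usual ordering `A ≤ B` of positive selfadjoint operators: `dom B^{1/2} ⊆ dom A^{1/2}` and
`‖A^{1/2} y‖² ≤ ‖B^{1/2} y‖²` for `y ∈ dom B^{1/2}`. -/
def FormLE (A B : E →ₗ.[ℂ] E) : Prop :=
  ∀ (y : E) (m : ℝ), 0 ≤ m → FormBound B y m → FormBound A y m

/-- Positive selfadjoint operators. -/
def IsPosSelfAdjoint [CompleteSpace E] (A : E →ₗ.[ℂ] E) : Prop :=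
  IsPosSymm A ∧ IsSelfAdjoint A

end Basic

section Energy

variable {H : Type*} [NormedAddCommGroup H] [InnerProductSpace ℂ H]

/-- The space `dom a` with the semi-inner product `⟨x, y⟩ ↦ (a x, y)`. The map `x ↦ a x` is an
isometry of it onto `ran a` with the inner product `⟨a x, a y⟩ = (a x, y)`. -/
def EnergyDom {a : H →ₗ.[ℂ] H} (_ha : IsPosSymm a) : Type _ := a.domain

instance {a : H →ₗ.[ℂ] H} (ha : IsPosSymm a) : AddCommGroup (EnergyDom ha) :=
  inferInstanceAs (AddCommGroup a.domain)

instance {a : H →ₗ.[ℂ] H} (ha : IsPosSymm a) : Module ℂ (EnergyDom ha) :=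
  inferInstanceAs (Module ℂ a.domain)

/-- `dom a` as a linear space, with the energy semi-inner product put on it. -/
def toEnergyDom {a : H →ₗ.[ℂ] H} (ha : IsPosSymm a) : a.domain ≃ₗ[ℂ] EnergyDom ha :=
  LinearEquiv.refl ℂ a.domain

/-- The semi-inner product `(a x, y)` on `dom a`. -/
abbrev energyCore {a : H →ₗ.[ℂ] H} (ha : IsPosSymm a) :
    PreInnerProductSpace.Core ℂ (EnergyDom ha) where
  inner x y := inner ℂ (a ((toEnergyDom ha).symm x)) (((toEnergyDom ha).symm y : a.domain) : H)
  conj_inner_symm x y := by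
    rw [inner_conj_symm]; exact (ha.symm _ _).symm
  re_inner_nonneg x := ha.nonneg _
  add_left x y z := by
    rw [map_add, a.map_add, inner_add_left]
  smul_left x y r := by
    rw [map_smul, a.map_smul, inner_smul_left]

instance {a : H →ₗ.[ℂ] H} (ha : IsPosSymm a) : SeminormedAddCommGroup (EnergyDom ha) :=
  @InnerProductSpace.Core.toSeminormedAddCommGroup ℂ (EnergyDom ha) _ _ _ (energyCore ha)

instance {a : H →ₗ.[ℂ] H} (ha : IsPosSymm a) : InnerProductSpace ℂ (EnergyDom ha) :=
  InnerProductSpace.ofCore (energyCore ha)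

/-- The Hilbert space `H_a`: the Hausdorff completion of `dom a` for `(a x, y)`, that is, the
completion of `ran a` for `⟨a x, a y⟩ = (a x, y)`. -/
abbrev EnergySpace {a : H →ₗ.[ℂ] H} (ha : IsPosSymm a) : Type _ :=
  UniformSpace.Completion (EnergyDom ha)

/-- The vector of `H_a` given by `a x ∈ ran a`, as a linear function of `x ∈ dom a`. -/
def toEnergy {a : H →ₗ.[ℂ] H} (ha : IsPosSymm a) : a.domain →ₗ[ℂ] EnergySpace ha :=
  (UniformSpace.Completion.toComplL (𝕜 := ℂ) (E := EnergyDom ha)).toLinearMap ∘ₗ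
    (toEnergyDom ha).toLinearMap

theorem inner_toEnergy {a : H →ₗ.[ℂ] H} (ha : IsPosSymm a) (x y : a.domain) :
    inner ℂ (toEnergy ha x) (toEnergy ha y) = inner ℂ (a x) (y : H) :=
  UniformSpace.Completion.inner_coe (𝕜 := ℂ) (toEnergyDom ha x) (toEnergyDom ha y)

/-- The operator `J_a : H_a → H` with domain `ran a ⊆ H_a`, `J_a (a x) = a x`, given by its graph
(it is single-valued as soon as the form domain of `a` is dense). -/
def opJ {a : H →ₗ.[ℂ] H} (ha : IsPosSymm a) : EnergySpace ha →ₗ.[ℂ] H :=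
  (LinearMap.range ((toEnergy ha).prod a.toFun)).toLinearPMap

/-- The operator `Q_a : H → H_a` with domain `dom a`, `Q_a x = a x ∈ ran a ⊆ H_a`. -/
def opQ {a : H →ₗ.[ℂ] H} (ha : IsPosSymm a) : H →ₗ.[ℂ] EnergySpace ha where
  domain := a.domain
  toFun := toEnergy ha

/-- The operator `J : H_a ⊕ H_b → H` with domain `ran a ⊕ ran b`, `J (a x ⊕ b y) = a x + b y`, given
by its graph (single-valued as soon as the form domains of `a` and `b` have a dense intersection);
`⊕` is the Hilbert space direct sum. -/
def opJSum {a b : H →ₗ.[ℂ] H} (ha : IsPosSymm a) (hb : IsPosSymm b) :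
    WithLp 2 (EnergySpace ha × EnergySpace hb) →ₗ.[ℂ] H :=
  (LinearMap.range
    (((WithLp.linearEquiv 2 ℂ (EnergySpace ha × EnergySpace hb)).symm.toLinearMap ∘ₗ
        (toEnergy ha).prodMap (toEnergy hb)).prod
      (a.toFun.coprod b.toFun))).toLinearPMap

variable [CompleteSpace H]

/-- The Krein-von Neumann extension `a_K = J_a** J_a*`. -/
def kreinExt {a : H →ₗ.[ℂ] H} (ha : IsPosSymm a) : H →ₗ.[ℂ] H :=
  opMul (opJ ha).adjoint.adjoint (opJ ha).adjoint

/-- The Friedrichs extension `a_F = Q_a* Q_a**`. -/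
def friedrichsExt {a : H →ₗ.[ℂ] H} (ha : IsPosSymm a) : H →ₗ.[ℂ] H :=
  opMul (opQ ha).adjoint (opQ ha).adjoint.adjoint

/-- The form sum `a ∔ b = J** J*`. -/
def formSum {a b : H →ₗ.[ℂ] H} (ha : IsPosSymm a) (hb : IsPosSymm b) : H →ₗ.[ℂ] H :=
  opMul (opJSum ha hb).adjoint.adjoint (opJSum ha hb).adjoint

theorem kreinExt_isPosSymm {a : H →ₗ.[ℂ] H} (ha : IsPosSymm a) : IsPosSymm (kreinExt ha) :=
  isPosSymm_adjoint_mul_self _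

theorem friedrichsExt_isPosSymm {a : H →ₗ.[ℂ] H} (ha : IsPosSymm a) :
    IsPosSymm (friedrichsExt ha) :=
  isPosSymm_self_mul_adjoint _

end Energy

end FormSum

end

namespace FormSum

open LinearPMap Submodule

/-! ### Unbounded operators through their graphs -/

section Graphs

variable {E F G : Type*}
  [NormedAddCommGroup E] [InnerProductSpace ℂ E]
  [NormedAddCommGroup F] [InnerProductSpace ℂ F]
  [NormedAddCommGroup G] [InnerProductSpace ℂ G]

/-! Everything is read off from one bounded map. The lower bound makes the embedding `energyEmb` of
H_a into H, written ι below, bounded; its adjoint ι* (`energyProj`) sends `a x` back to the vector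
of H_a that `a x` represents. In these terms Q_a* is the inverse of ι* and Q_a** the inverse of ι,
so a_F is the inverse of ιι* (`mem_graph_friedrichsExt`). Since `a` is closed with a lower bound,
its range is closed; with N = (ran a)ᗮ, J_a* relates ιξ + n to ξ for n in N, so a_K lives on dom a +
N and sends x + n to a x (`mem_graph_kreinExt`). N is nonzero because a symmetric surjective
operator is selfadjoint.

N meets ran ιι* only in 0 (`eq_zero_of_mem_orthogonal_of_eq_energyInv`), hence a_K + a_F is just 2a,
with Krein extension 2a_K. The form sum sees forms instead of domains: the energy spaces of a_K and
a_F are both copies of H_a, so J* sends ιζ to two copies of ζ, and J**J* = 2a_F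
(`formSum_kreinExt_friedrichsExt`). The results differ, as a_K kills N while a_F is injective.

For the example, K is an injective bounded symmetric operator and n lies outside its range; the
inverse of K² restricted to K²(nᗮ) is an admissible `a`. -/

theorem exists_of_mem_graph {T : E →ₗ.[ℂ] F} {u : E} {v : F} (h : (u, v) ∈ T.graph) :
    ∃ x : T.domain, (x : E) = u ∧ T x = v :=
  (mem_graph_iff T).1 h

theorem mem_graph_opMul {g : F →ₗ.[ℂ] G} {f : E →ₗ.[ℂ] F} {x : E} {z : G} :
    (x, z) ∈ (opMul g f).graph ↔ ∃ y, (x, y) ∈ f.graph ∧ (y, z) ∈ g.graph := by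
  constructor
  · intro h
    obtain ⟨w, rfl, rfl⟩ := exists_of_mem_graph h
    obtain ⟨h1, h2, h3⟩ := opMul_apply_mem g f w
    exact ⟨_, mem_graph f ⟨w, h1⟩, h3 ▸ mem_graph g ⟨_, h2⟩⟩
  · rintro ⟨y, hf, hg⟩
    obtain ⟨x', rfl, rfl⟩ := exists_of_mem_graph hf
    obtain ⟨y', hy, rfl⟩ := exists_of_mem_graph hg
    have hx : (x' : E) ∈ (opMul g f).domain := ⟨x', (hy ▸ y'.2 : f x' ∈ g.domain), rfl⟩
    refine (mem_graph_iff _).2 ⟨⟨x', hx⟩, rfl, ?_⟩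
    obtain ⟨h1, h2, h3⟩ := opMul_apply_mem g f ⟨x', hx⟩
    rw [h3]
    exact congrArg g (Subtype.ext hy.symm)

theorem mem_graph_adjoint [CompleteSpace E] {T : E →ₗ.[ℂ] F} (hT : Dense (T.domain : Set E))
    {y : F} {z : E} :
    (y, z) ∈ T.adjoint.graph ↔ ∀ x : T.domain, inner ℂ (T x) y = inner ℂ (x : E) z := by
  rw [adjoint_graph_eq_graph_adjoint hT, Submodule.mem_adjoint_iff]
  constructor
  · intro h x
    exact sub_eq_zero.1 (h _ _ (mem_graph T x))
  · intro h u v huv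
    obtain ⟨x, rfl, rfl⟩ := exists_of_mem_graph huv
    exact sub_eq_zero.2 (h x)

theorem mem_graph_adjoint' [CompleteSpace E] {T : E →ₗ.[ℂ] F} (hT : Dense (T.domain : Set E))
    {y : F} {z : E} :
    (y, z) ∈ T.adjoint.graph ↔ ∀ u v, (u, v) ∈ T.graph → inner ℂ v y = inner ℂ u z := by
  rw [mem_graph_adjoint hT]
  constructor
  · intro h u v huv
    obtain ⟨x, rfl, rfl⟩ := exists_of_mem_graph huv
    exact h x
  · intro h x
    exact h _ _ (mem_graph T x)

theorem eq_of_mem_graph_iff {S T : E →ₗ.[ℂ] F} (h : ∀ x y, (x, y) ∈ S.graph ↔ (x, y) ∈ T.graph) :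
    S = T :=
  eq_of_eq_graph (Submodule.ext fun ⟨x, y⟩ => h x y)

theorem le_of_mem_graph {S T : E →ₗ.[ℂ] F} (h : ∀ x : S.domain, ((x : E), S x) ∈ T.graph) :
    S ≤ T := by
  refine le_of_le_graph fun ⟨u, v⟩ huv => ?_
  obtain ⟨x, rfl, rfl⟩ := exists_of_mem_graph huv
  exact h x

theorem isSelfAdjoint_of_graph [CompleteSpace E] {T : E →ₗ.[ℂ] E}
    (hd : Dense (T.domain : Set E))
    (h : ∀ y z, (∀ u v, (u, v) ∈ T.graph → inner ℂ v y = inner ℂ u z) ↔ (y, z) ∈ T.graph) :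
    IsSelfAdjoint T := by
  rw [LinearPMap.isSelfAdjoint_def]
  exact eq_of_mem_graph_iff fun y z => (mem_graph_adjoint' hd).trans (h y z)

theorem mem_graph_smul {T : E →ₗ.[ℂ] F} {c : ℂ} (hc : c ≠ 0) {x : E} {y : F} :
    (x, y) ∈ (c • T).graph ↔ (x, c⁻¹ • y) ∈ T.graph := by
  simp only [mem_graph_iff]
  constructor
  · rintro ⟨z, rfl, rfl⟩
    refine ⟨z, rfl, ?_⟩
    rw [LinearPMap.smul_apply, inv_smul_smul₀ hc]
  · rintro ⟨z, rfl, h⟩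
    refine ⟨z, rfl, ?_⟩
    rw [LinearPMap.smul_apply, h, smul_inv_smul₀ hc]

theorem dense_of_forall_inner_eq_zero [CompleteSpace E] {p : Submodule ℂ E}
    (h : ∀ y, (∀ x ∈ p, inner ℂ x y = 0) → y = 0) : Dense (p : Set E) := by
  rw [Submodule.dense_iff_topologicalClosure_eq_top, Submodule.topologicalClosure_eq_top_iff,
    Submodule.eq_bot_iff]
  exact fun y hy => h y ((Submodule.mem_orthogonal _ _).1 hy)

/-- The operator with graph `{(f v, h v)}`. -/
theorem graph_toLinearPMap_range {V : Type*} [AddCommGroup V] [Module ℂ V] {f : V →ₗ[ℂ] E}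
    {h : V →ₗ[ℂ] F} (hfh : ∀ v, f v = 0 → h v = 0) :
    (LinearMap.range (f.prod h)).toLinearPMap.graph = LinearMap.range (f.prod h) := by
  refine Submodule.toLinearPMap_graph_eq _ ?_
  rintro _ ⟨v, rfl⟩ hv
  exact hfh v hv

theorem coe_domain_toLinearPMap_range {V : Type*} [AddCommGroup V] [Module ℂ V] (f : V →ₗ[ℂ] E)
    (h : V →ₗ[ℂ] F) :
    ((LinearMap.range (f.prod h)).toLinearPMap.domain : Set E) = Set.range f := by
  ext x
  simp [Submodule.toLinearPMap_domain]

theorem mem_graph_adjoint_range [CompleteSpace E] {V : Type*} [AddCommGroup V] [Module ℂ V]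
    {f : V →ₗ[ℂ] E} {h : V →ₗ[ℂ] F} (hf : DenseRange f) (hfh : ∀ v, f v = 0 → h v = 0)
    {y : F} {z : E} :
    (y, z) ∈ (LinearMap.range (f.prod h)).toLinearPMap.adjoint.graph ↔
      ∀ v, inner ℂ (h v) y = inner ℂ (f v) z := by
  rw [mem_graph_adjoint' (by rw [coe_domain_toLinearPMap_range]; exact hf),
    graph_toLinearPMap_range hfh]
  constructor
  · intro H v
    exact H _ _ ⟨v, rfl⟩
  · rintro H u v ⟨w, hw⟩
    obtain ⟨rfl, rfl⟩ := Prod.mk.inj hw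
    exact H w

/-- The inverse of an injective bounded operator. -/
noncomputable def boundedInverse (R : E →L[ℂ] E) : E →ₗ.[ℂ] E :=
  (LinearMap.range (R.toLinearMap.prod LinearMap.id)).toLinearPMap

theorem mem_graph_boundedInverse {R : E →L[ℂ] E} (hR : ∀ z, R z = 0 → z = 0) {x y : E} :
    (x, y) ∈ (boundedInverse R).graph ↔ x = R y := by
  rw [boundedInverse, graph_toLinearPMap_range (by simpa using hR)]
  constructor
  · rintro ⟨w, hw⟩
    obtain ⟨rfl, rfl⟩ := Prod.mk.inj hw
    rfl
  · rintro rfl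
    exact ⟨y, rfl⟩

/-- The orthogonal complement of ran R is ker R = 0, so the domain is dense; testing against (R v,
v) turns the adjoint relation into y = R z. -/
theorem isSelfAdjoint_of_graph_inverse [CompleteSpace E] {R : E →L[ℂ] E}
    (hs : ∀ x y, inner ℂ (R x) y = inner ℂ x (R y)) (hR : ∀ z, R z = 0 → z = 0)
    {T : E →ₗ.[ℂ] E} (hT : ∀ x y, (x, y) ∈ T.graph ↔ x = R y) : IsSelfAdjoint T := by
  refine isSelfAdjoint_of_graph (dense_of_forall_inner_eq_zero fun y hy => hR y ?_) fun y z => ?_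
  · refine ext_inner_left ℂ fun v => ?_
    rw [← hs, inner_zero_right]
    exact hy _ (mem_domain_of_mem_graph ((hT _ _).2 rfl))
  · simp only [hT]
    constructor
    · intro h
      exact ext_inner_left ℂ fun v => by rw [← hs]; exact h _ _ rfl
    · rintro rfl u v rfl
      rw [hs]

end Graphs

/-! ### Energy space and explicit graphs of the two extensions -/

section LowerBound

variable {H : Type*} [NormedAddCommGroup H] [InnerProductSpace ℂ H]

theorem norm_toEnergy_sq {a : H →ₗ.[ℂ] H} (ha : IsPosSymm a) (x : a.domain) :
    ‖toEnergy ha x‖ ^ 2 = (inner ℂ (a x) (x : H)).re := by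
  rw [← inner_toEnergy ha, ← inner_self_eq_norm_sq (𝕜 := ℂ)]
  rfl

theorem denseRange_toEnergy {a : H →ₗ.[ℂ] H} (ha : IsPosSymm a) : DenseRange (toEnergy ha) :=
  UniformSpace.Completion.denseRange_coe.comp (toEnergyDom ha).surjective.denseRange
    (UniformSpace.Completion.continuous_coe _)

/-- Cauchy–Schwarz in the energy space of T. -/
theorem IsPosSymm.norm_inner_sq_le {T : H →ₗ.[ℂ] H} (hT : IsPosSymm T) (x y : T.domain) :
    ‖inner ℂ (T x) (y : H)‖ ^ 2 ≤
      (inner ℂ (T y) (y : H)).re * (inner ℂ (T x) (x : H)).re := by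
  rw [← inner_toEnergy hT, ← norm_toEnergy_sq hT, ← norm_toEnergy_sq hT, ← mul_pow, mul_comm]
  gcongr
  exact norm_inner_le_norm _ _

/-- `a` has a positive lower bound. -/
def HasPosLowerBound (a : H →ₗ.[ℂ] H) : Prop :=
  ∃ c : ℝ, 0 < c ∧ ∀ x : a.domain, c * ‖(x : H)‖ ^ 2 ≤ (inner ℂ (a x) (x : H)).re

/-- This makes J_a single-valued. -/
theorem eq_zero_of_toEnergy_eq_zero {a : H →ₗ.[ℂ] H} (ha : IsPosSymm a)
    (hd : Dense (a.domain : Set H)) {x : a.domain} (hx : toEnergy ha x = 0) : a x = 0 := by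
  refine hd.eq_zero_of_inner_left ℂ fun y hy => ?_
  rw [← inner_toEnergy ha x ⟨y, hy⟩, hx, inner_zero_left]

theorem exists_norm_le_toEnergy {a : H →ₗ.[ℂ] H} (ha : IsPosSymm a) (hc : HasPosLowerBound a) :
    ∃ C : ℝ, ∀ x : a.domain, ‖a.domain.subtype x‖ ≤ C * ‖toEnergy ha x‖ := by
  obtain ⟨c, hc0, hc⟩ := hc
  refine ⟨√c⁻¹, fun x => ?_⟩
  refine le_of_sq_le_sq ?_ (by positivity)
  rw [mul_pow, norm_toEnergy_sq, Real.sq_sqrt (by positivity)]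
  rw [inv_mul_eq_div, le_div_iff₀ hc0, mul_comm]
  exact hc x

/-- The embedding of the energy space of an operator with positive lower bound,
`toEnergy ha x ↦ x`. -/
noncomputable def energyEmb [CompleteSpace H] {a : H →ₗ.[ℂ] H} (ha : IsPosSymm a) :
    EnergySpace ha →L[ℂ] H :=
  a.domain.subtype.extendOfNorm (toEnergy ha)

variable [CompleteSpace H] {a : H →ₗ.[ℂ] H} (ha : IsPosSymm a)

theorem energyEmb_toEnergy (hc : HasPosLowerBound a) (x : a.domain) :
    energyEmb ha (toEnergy ha x) = x :=
  LinearMap.extendOfNorm_eq (denseRange_toEnergy ha) (exists_norm_le_toEnergy ha hc) x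

theorem inner_energyEmb (hc : HasPosLowerBound a) (x : a.domain) (ξ : EnergySpace ha) :
    inner ℂ (a x) (energyEmb ha ξ) = inner ℂ (toEnergy ha x) ξ := by
  refine (denseRange_toEnergy ha).induction_on ξ (isClosed_eq (by fun_prop) (by fun_prop)) ?_
  intro y
  rw [energyEmb_toEnergy ha hc, inner_toEnergy]

/-- The adjoint of `energyEmb`. -/
noncomputable abbrev energyProj : H →L[ℂ] EnergySpace ha :=
  (energyEmb ha).adjoint

theorem energyProj_apply (hc : HasPosLowerBound a) (x : a.domain) :
    energyProj ha (a x) = toEnergy ha x := by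
  refine ext_inner_right ℂ fun ξ => ?_
  rw [ContinuousLinearMap.adjoint_inner_left, inner_energyEmb ha hc]

theorem eq_zero_of_energyProj_eq_zero (hd : Dense (a.domain : Set H)) (hc : HasPosLowerBound a)
    {z : H} (h : energyProj ha z = 0) : z = 0 := by
  refine hd.eq_zero_of_inner_left ℂ fun y hy => ?_
  have := ContinuousLinearMap.adjoint_inner_left (energyEmb ha) (toEnergy ha ⟨y, hy⟩) z
  rw [energyEmb_toEnergy ha hc, h, inner_zero_left] at this
  exact this.symm

theorem denseRange_energyProj (hc : HasPosLowerBound a) : DenseRange (energyProj ha) := by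
  refine (denseRange_toEnergy ha).mono ?_
  rintro _ ⟨x, rfl⟩
  exact ⟨a x, energyProj_apply ha hc x⟩

theorem mem_graph_adjoint_opQ (hd : Dense (a.domain : Set H)) (hc : HasPosLowerBound a)
    {ξ : EnergySpace ha} {z : H} :
    (ξ, z) ∈ (opQ ha).adjoint.graph ↔ ξ = energyProj ha z := by
  rw [mem_graph_adjoint (T := opQ ha) hd]
  have key : ∀ x : a.domain, inner ℂ (x : H) z = inner ℂ (toEnergy ha x) (energyProj ha z) := by
    intro x
    rw [ContinuousLinearMap.adjoint_inner_right, energyEmb_toEnergy ha hc]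
  constructor
  · intro h
    refine ext_inner_left ℂ fun η => ?_
    refine (denseRange_toEnergy ha).induction_on η (isClosed_eq (by fun_prop) (by fun_prop)) ?_
    exact fun x => (h x).trans (key x)
  · rintro rfl x
    exact (key x).symm

theorem mem_graph_adjoint_adjoint_opQ (hd : Dense (a.domain : Set H)) (hc : HasPosLowerBound a)
    {u : H} {ξ : EnergySpace ha} :
    (u, ξ) ∈ (opQ ha).adjoint.adjoint.graph ↔ u = energyEmb ha ξ := by
  rw [mem_graph_adjoint']
  · simp only [mem_graph_adjoint_opQ ha hd hc]
    constructor
    · intro h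
      refine ext_inner_left ℂ fun z => ?_
      rw [h _ z rfl, ContinuousLinearMap.adjoint_inner_left]
    · rintro rfl η z rfl
      rw [ContinuousLinearMap.adjoint_inner_left]
  · refine (denseRange_energyProj ha hc).mono ?_
    rintro _ ⟨z, rfl⟩
    exact mem_domain_of_mem_graph ((mem_graph_adjoint_opQ ha hd hc).2 rfl)

theorem mem_graph_friedrichsExt (hd : Dense (a.domain : Set H)) (hc : HasPosLowerBound a)
    {x z : H} :
    (x, z) ∈ (friedrichsExt ha).graph ↔ x = energyEmb ha (energyProj ha z) := by
  simp only [friedrichsExt, mem_graph_opMul, mem_graph_adjoint_adjoint_opQ ha hd hc,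
    mem_graph_adjoint_opQ ha hd hc, exists_eq_right]

/-- Membership says that (a x, y) = (a x, ιξ) for all x, that is, y - ιξ is orthogonal to ran a. -/
theorem mem_graph_adjoint_opJ (hd : Dense (a.domain : Set H)) (hc : HasPosLowerBound a)
    {y : H} {ξ : EnergySpace ha} :
    (y, ξ) ∈ (opJ ha).adjoint.graph ↔ ∃ n ∈ (LinearMap.range a.toFun)ᗮ, y = energyEmb ha ξ + n := by
  rw [opJ, mem_graph_adjoint_range (denseRange_toEnergy ha)
    (fun x hx => eq_zero_of_toEnergy_eq_zero ha hd hx)]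
  simp only [← inner_energyEmb ha hc]
  constructor
  · intro h
    refine ⟨y - energyEmb ha ξ, ?_, by abel⟩
    rw [Submodule.mem_orthogonal]
    rintro _ ⟨x, rfl⟩
    rw [inner_sub_right, sub_eq_zero]
    exact h x
  · rintro ⟨n, hn, rfl⟩ x
    have : inner ℂ (a x) n = 0 := (Submodule.mem_orthogonal _ _).1 hn _ ⟨x, rfl⟩
    rw [inner_add_right]
    simp [this]

/-- J_a is already closed: testing against (n, 0) puts u into the double orthogonal complement of
ran a, which is ran a itself, and testing against (ιη, η) gives ξ = ι*u. -/
theorem mem_graph_adjoint_adjoint_opJ (hd : Dense (a.domain : Set H)) (hc : HasPosLowerBound a)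
    (hr : IsClosed (LinearMap.range a.toFun : Set H)) {ξ : EnergySpace ha} {u : H} :
    (ξ, u) ∈ (opJ ha).adjoint.adjoint.graph ↔ ∃ x : a.domain, ξ = toEnergy ha x ∧ u = a x := by
  have key := fun y ξ => mem_graph_adjoint_opJ ha hd hc (y := y) (ξ := ξ)
  rw [mem_graph_adjoint']
  · simp only [key]
    constructor
    · intro h
      have hu : u ∈ LinearMap.range a.toFun := by
        rw [← hr.submodule_topologicalClosure_eq, ← Submodule.orthogonal_orthogonal_eq_closure,
          Submodule.mem_orthogonal]
        intro n hn
        have := h n 0 ⟨n, hn, by simp⟩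
        simpa using this.symm
      obtain ⟨x, rfl⟩ := hu
      refine ⟨x, ?_, rfl⟩
      rw [← energyProj_apply ha hc]
      refine ext_inner_left ℂ fun η => ?_
      rw [ContinuousLinearMap.adjoint_inner_right]
      exact h _ η ⟨0, zero_mem _, by simp⟩
    · rintro ⟨x, rfl, rfl⟩ y η ⟨n, hn, rfl⟩
      have : inner ℂ n (a x) = 0 := (Submodule.mem_orthogonal' _ _).1 hn _ ⟨x, rfl⟩
      rw [inner_add_left, this, add_zero, ← energyProj_apply ha hc,
        ContinuousLinearMap.adjoint_inner_right]
  · refine hd.mono fun x hx => ?_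
    refine mem_domain_of_mem_graph (y := toEnergy ha ⟨x, hx⟩) ((key _ _).2 ⟨0, zero_mem _, ?_⟩)
    rw [energyEmb_toEnergy ha hc, add_zero]

theorem mem_graph_kreinExt (hd : Dense (a.domain : Set H)) (hc : HasPosLowerBound a)
    (hr : IsClosed (LinearMap.range a.toFun : Set H)) {y z : H} :
    (y, z) ∈ (kreinExt ha).graph ↔
      ∃ x : a.domain, ∃ n ∈ (LinearMap.range a.toFun)ᗮ, y = x + n ∧ z = a x := by
  simp only [kreinExt, mem_graph_opMul, mem_graph_adjoint_opJ ha hd hc,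
    mem_graph_adjoint_adjoint_opJ ha hd hc hr]
  constructor
  · rintro ⟨_, ⟨n, hn, rfl⟩, x, rfl, rfl⟩
    exact ⟨x, n, hn, by rw [energyEmb_toEnergy ha hc], rfl⟩
  · rintro ⟨x, n, hn, rfl, rfl⟩
    exact ⟨_, ⟨n, hn, by rw [energyEmb_toEnergy ha hc]⟩, x, rfl, rfl⟩

end LowerBound

/-! ### Selfadjoint extensions and their ordering -/

section Extensions

variable {H : Type*} [NormedAddCommGroup H] [InnerProductSpace ℂ H] [CompleteSpace H]
  {a : H →ₗ.[ℂ] H} (ha : IsPosSymm a)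

theorem HasPosLowerBound.isClosed_range (hc : HasPosLowerBound a) (hcl : a.IsClosed) :
    IsClosed (LinearMap.range a.toFun : Set H) := by
  obtain ⟨c, hc0, hc⟩ := hc
  have hnorm : ∀ x : a.domain, c * ‖(x : H)‖ ≤ ‖a x‖ := by
    intro x
    by_cases hx : ‖(x : H)‖ = 0
    · rw [hx, mul_zero]; positivity
    · have h1 := (hc x).trans ((Complex.re_le_norm _).trans (norm_inner_le_norm (𝕜 := ℂ) _ _))
      rw [pow_two, ← mul_assoc] at h1
      exact le_of_mul_le_mul_right h1 (lt_of_le_of_ne (norm_nonneg _) (Ne.symm hx))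
  have : CompleteSpace a.graph := hcl.completeSpace_coe
  let f : a.graph →L[ℂ] H := (ContinuousLinearMap.snd ℂ H H).comp a.graph.subtypeL
  -- The graph carries the max norm: c⁻¹ controls the first coordinate by ‖a x‖, and 1 the second.
  have hf : AntilipschitzWith (max c⁻¹ 1).toNNReal f := by
    refine f.antilipschitz_of_bound fun ⟨⟨u, v⟩, huv⟩ => ?_
    obtain ⟨x, rfl, rfl⟩ := exists_of_mem_graph huv
    rw [Real.coe_toNNReal _ (by positivity)]
    change max ‖(x : H)‖ ‖a x‖ ≤ max c⁻¹ 1 * ‖a x‖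
    refine max_le ?_ (le_mul_of_one_le_left (norm_nonneg _) (le_max_right _ _))
    refine le_trans ?_ (mul_le_mul_of_nonneg_right (le_max_left _ _) (norm_nonneg _))
    rw [inv_mul_eq_div, le_div_iff₀ hc0, mul_comm]
    exact hnorm x
  have hr := hf.isClosed_range f.uniformContinuous
  convert hr using 1
  ext v
  constructor
  · rintro ⟨x, rfl⟩
    exact ⟨⟨_, mem_graph a x⟩, rfl⟩
  · rintro ⟨⟨⟨u, v⟩, huv⟩, rfl⟩
    obtain ⟨x, rfl, rfl⟩ := exists_of_mem_graph huv
    exact ⟨x, rfl⟩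

/-- The inverse of the Friedrichs extension of an operator with positive lower bound. -/
noncomputable def energyInv : H →L[ℂ] H :=
  (energyEmb ha).comp (energyProj ha)

theorem energyInv_apply (z : H) : energyInv ha z = energyEmb ha (energyProj ha z) := rfl

theorem inner_energyInv (y z : H) :
    inner ℂ y (energyInv ha z) = inner ℂ (energyProj ha y) (energyProj ha z) := by
  rw [energyInv_apply, ContinuousLinearMap.adjoint_inner_left]

theorem energyInv_inner (y z : H) :
    inner ℂ (energyInv ha y) z = inner ℂ (energyProj ha y) (energyProj ha z) := by
  rw [energyInv_apply, ContinuousLinearMap.adjoint_inner_right]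

theorem energyInv_comp (hc : HasPosLowerBound a) (x : a.domain) : energyInv ha (a x) = x := by
  rw [energyInv_apply, energyProj_apply ha hc, energyEmb_toEnergy ha hc]

theorem eq_zero_of_energyInv_eq_zero (hd : Dense (a.domain : Set H)) (hc : HasPosLowerBound a)
    {z : H} (h : energyInv ha z = 0) : z = 0 := by
  refine eq_zero_of_energyProj_eq_zero ha hd hc ?_
  rw [← inner_self_eq_zero (𝕜 := ℂ), ← inner_energyInv, h, inner_zero_right]

theorem friedrichsExt_isPosSelfAdjoint (hd : Dense (a.domain : Set H)) (hc : HasPosLowerBound a) :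
    IsPosSelfAdjoint (friedrichsExt ha) :=
  ⟨friedrichsExt_isPosSymm ha, isSelfAdjoint_of_graph_inverse (R := energyInv ha)
    (fun x y => by rw [inner_energyInv, energyInv_inner])
    (fun _ => eq_zero_of_energyInv_eq_zero ha hd hc)
    (fun _ _ => mem_graph_friedrichsExt ha hd hc)⟩

theorem le_friedrichsExt (hd : Dense (a.domain : Set H)) (hc : HasPosLowerBound a) :
    a ≤ friedrichsExt ha :=
  le_of_mem_graph fun x =>
    (mem_graph_friedrichsExt ha hd hc).2 (energyInv_comp ha hc x).symm

theorem le_kreinExt (hd : Dense (a.domain : Set H)) (hc : HasPosLowerBound a)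
    (hr : IsClosed (LinearMap.range a.toFun : Set H)) : a ≤ kreinExt ha :=
  le_of_mem_graph fun x =>
    (mem_graph_kreinExt ha hd hc hr).2 ⟨x, 0, zero_mem _, (add_zero _).symm, rfl⟩

theorem kreinExt_isPosSelfAdjoint (hd : Dense (a.domain : Set H)) (hc : HasPosLowerBound a)
    (hr : IsClosed (LinearMap.range a.toFun : Set H)) :
    IsPosSelfAdjoint (kreinExt ha) := by
  refine ⟨kreinExt_isPosSymm ha, isSelfAdjoint_of_graph
    (hd.mono (le_kreinExt ha hd hc hr).1) fun y z => ⟨fun h => ?_, fun h u v huv => ?_⟩⟩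
  · simp only [mem_graph_kreinExt ha hd hc hr] at h ⊢
    have hz : z ∈ LinearMap.range a.toFun := by
      rw [← hr.submodule_topologicalClosure_eq, ← Submodule.orthogonal_orthogonal_eq_closure,
        Submodule.mem_orthogonal]
      intro n hn
      have := h n 0 ⟨0, n, hn, by simp, by simp⟩
      simpa using this.symm
    obtain ⟨x, rfl⟩ := hz
    refine ⟨x, y - x, ?_, by abel, rfl⟩
    rw [Submodule.mem_orthogonal]
    rintro _ ⟨x', rfl⟩
    have h1 := h x' (a x') ⟨x', 0, zero_mem _, by simp, rfl⟩
    rw [inner_sub_right, sub_eq_zero]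
    exact h1.trans (ha.symm x' x).symm
  · obtain ⟨x, rfl, rfl⟩ := exists_of_mem_graph h
    obtain ⟨x', rfl, rfl⟩ := exists_of_mem_graph huv
    exact (kreinExt_isPosSymm ha).symm x' x

/-- Taking adjoints reverses inclusions. -/
theorem le_adjoint_of_isSelfAdjoint {T : H →ₗ.[ℂ] H} (hd : Dense (a.domain : Set H))
    (hT : IsSelfAdjoint T) (haT : a ≤ T) : T ≤ a.adjoint := by
  refine le_of_mem_graph fun x => (mem_graph_adjoint' hd).2 fun u v huv => ?_
  have hx : ((x : H), T x) ∈ T.adjoint.graph :=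
    (LinearPMap.isSelfAdjoint_def.1 hT).symm ▸ mem_graph T x
  exact (mem_graph_adjoint' hT.dense_domain).1 hx u v (le_graph_of_le haT huv)

/-- Otherwise `a` is onto. If (y, z) is in the graph of the adjoint and z = a x, then y - x is
orthogonal to ran a, so y = x and `a` is selfadjoint. -/
theorem exists_ne_zero_mem_orthogonal_range
    (ha : IsPosSymm a) (hd : Dense (a.domain : Set H))
    (hr : IsClosed (LinearMap.range a.toFun : Set H)) (hns : ¬ IsSelfAdjoint a) :
    ∃ n ∈ (LinearMap.range a.toFun)ᗮ, n ≠ 0 := by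
  rw [← Submodule.ne_bot_iff]
  intro hbot
  refine hns (isSelfAdjoint_of_graph hd fun y z => ⟨fun h => ?_, fun h u v huv => ?_⟩)
  · have hz : z ∈ LinearMap.range a.toFun := by
      rw [← hr.submodule_topologicalClosure_eq, ← Submodule.orthogonal_orthogonal_eq_closure,
        hbot, Submodule.bot_orthogonal_eq_top]
      trivial
    obtain ⟨x, rfl⟩ := hz
    have : y - x ∈ (LinearMap.range a.toFun)ᗮ := by
      rw [Submodule.mem_orthogonal]
      rintro _ ⟨x', rfl⟩
      rw [inner_sub_right, sub_eq_zero]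
      exact (h _ _ (mem_graph a x')).trans (ha.symm x' x).symm
    rw [hbot, Submodule.mem_bot, sub_eq_zero] at this
    rw [this]
    exact mem_graph a x
  · obtain ⟨x, rfl, rfl⟩ := exists_of_mem_graph h
    obtain ⟨x', rfl, rfl⟩ := exists_of_mem_graph huv
    exact ha.symm x' x

theorem mem_graph_adjoint_zero_of_mem_orthogonal (hd : Dense (a.domain : Set H)) {n : H}
    (hn : n ∈ (LinearMap.range a.toFun)ᗮ) : (n, 0) ∈ a.adjoint.graph := by
  rw [mem_graph_adjoint hd]
  intro x
  rw [inner_zero_right]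
  exact (Submodule.mem_orthogonal _ _).1 hn _ ⟨x, rfl⟩

theorem rank_ker_adjoint_pos (hd : Dense (a.domain : Set H)) {n : H}
    (hn : n ∈ (LinearMap.range a.toFun)ᗮ) (hn0 : n ≠ 0) :
    0 < Module.rank ℂ (LinearMap.ker a.adjoint.toFun) := by
  obtain ⟨x, hx, hx0⟩ := exists_of_mem_graph (mem_graph_adjoint_zero_of_mem_orthogonal hd hn)
  rw [rank_pos_iff_exists_ne_zero]
  refine ⟨⟨x, hx0⟩, fun h => hn0 ?_⟩
  rw [← hx]
  simpa using congrArg Subtype.val h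

/-- If n = ιι*z, then ι*z is orthogonal in H_a to every vector a x, because (a x, ιξ) is the energy
inner product with ξ; these vectors are dense. -/
theorem eq_zero_of_mem_orthogonal_of_eq_energyInv (hd : Dense (a.domain : Set H))
    (hc : HasPosLowerBound a) {n z : H}
    (hn : n ∈ (LinearMap.range a.toFun)ᗮ) (h : n = energyInv ha z) : n = 0 := by
  have hz : z = 0 := by
    refine eq_zero_of_energyProj_eq_zero ha hd hc ?_
    refine Dense.eq_zero_of_inner_right ℂ (denseRange_toEnergy ha) ?_
    rintro _ ⟨x, rfl⟩
    rw [← inner_energyEmb ha hc, ← energyInv_apply, ← h]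
    exact (Submodule.mem_orthogonal _ _).1 hn _ ⟨x, rfl⟩
  rw [h, hz, _root_.map_zero]

/-- The bounded inverses `a_F⁻¹ + t (n, ·) n` of selfadjoint extensions of `a`. -/
noncomputable def perturbedInv (n : H) (t : ℝ) : H →L[ℂ] H :=
  energyInv ha + (t : ℂ) • (innerSL ℂ n).smulRight n

theorem perturbedInv_apply (n : H) (t : ℝ) (z : H) :
    perturbedInv ha n t z = energyInv ha z + ((t : ℂ) * inner ℂ n z) • n := by
  simp [perturbedInv, mul_smul]

theorem infinite_selfAdjoint_extensions
    (ha : IsPosSymm a) (hd : Dense (a.domain : Set H)) (hc : HasPosLowerBound a)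
    {n : H} (hn : n ∈ (LinearMap.range a.toFun)ᗮ) (hn0 : n ≠ 0) :
    {T : H →ₗ.[ℂ] H | IsSelfAdjoint T ∧ a ≤ T}.Infinite := by
  have hinj : ∀ t z, perturbedInv ha n t z = 0 → z = 0 := by
    intro t z h
    rw [perturbedInv_apply] at h
    -- With a nonzero coefficient, n itself would lie in the range of `energyInv`, which meets (ran
    -- a)ᗮ only in 0.
    by_cases h0 : (t : ℂ) * inner ℂ n z = 0
    · rw [h0, zero_smul, add_zero] at h
      exact eq_zero_of_energyInv_eq_zero ha hd hc h
    · refine absurd (eq_zero_of_mem_orthogonal_of_eq_energyInv ha hd hc hn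
        (z := -((t : ℂ) * inner ℂ n z)⁻¹ • z) ?_) hn0
      rw [_root_.map_smul, eq_neg_of_add_eq_zero_left h, smul_neg, neg_smul, neg_neg, inv_smul_smul₀ h0]
  refine Set.infinite_of_injective_forall_mem (f := fun t : ℝ => boundedInverse (perturbedInv ha n t))
    (fun s t hst => ?_) fun t => ⟨?_, ?_⟩
  · have hst' : boundedInverse (perturbedInv ha n s) = boundedInverse (perturbedInv ha n t) := hst
    -- Evaluating at n separates the parameters, since (n, n) ≠ 0.
    have h1 : (perturbedInv ha n s n, n) ∈ (boundedInverse (perturbedInv ha n s)).graph :=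
      (mem_graph_boundedInverse (hinj s)).2 rfl
    have h2 := h1
    rw [hst', mem_graph_boundedInverse (hinj t), perturbedInv_apply, perturbedInv_apply,
      add_right_inj] at h2
    have h3 := mul_right_cancel₀ (inner_self_ne_zero.2 hn0) (smul_left_injective ℂ hn0 h2)
    exact_mod_cast h3
  · refine isSelfAdjoint_of_graph_inverse (fun x y => ?_) (hinj t)
      (fun _ _ => mem_graph_boundedInverse (hinj t))
    rw [perturbedInv_apply, perturbedInv_apply, inner_add_left, inner_add_right, inner_energyInv,
      energyInv_inner, inner_smul_left, inner_smul_right, map_mul, Complex.conj_ofReal,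
      inner_conj_symm]
    ring
  · refine le_of_mem_graph fun x => (mem_graph_boundedInverse (hinj t)).2 ?_
    have : inner ℂ n (a x) = 0 := (Submodule.mem_orthogonal' _ _).1 hn _ ⟨x, rfl⟩
    rw [perturbedInv_apply, energyInv_comp ha hc, this, mul_zero, zero_smul, add_zero]

/-- The N-part contributes nothing to the form of a_K, so a form bound for a_K is tested only on dom
a, where T agrees with `a`. -/
theorem kreinExt_le (hd : Dense (a.domain : Set H)) (hc : HasPosLowerBound a)
    (hr : IsClosed (LinearMap.range a.toFun : Set H)) {T : H →ₗ.[ℂ] H} (haT : a ≤ T) :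
    FormLE (kreinExt ha) T := by
  intro y m _ hy x
  obtain ⟨x₀, n, hn, h1, h2⟩ := (mem_graph_kreinExt ha hd hc hr).1 (mem_graph _ x)
  have hTx : T ⟨x₀, haT.1 x₀.2⟩ = a x₀ := (haT.2 rfl).symm
  have := hy ⟨x₀, haT.1 x₀.2⟩
  rw [hTx] at this
  have hn0 : inner ℂ (a x₀) n = 0 := (Submodule.mem_orthogonal _ _).1 hn _ ⟨x₀, rfl⟩
  rwa [h1, h2, inner_add_right, hn0, add_zero]

/-- As a_F is onto, the bound reads |(z, y)| ≤ √m ‖ι*z‖ for all z. This puts y in the domain of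
Q_a**, so y = ιξ. -/
theorem exists_eq_energyEmb_of_formBound (hd : Dense (a.domain : Set H)) (hc : HasPosLowerBound a)
    {y : H} {m : ℝ} (hm : 0 ≤ m) (hy : FormBound (friedrichsExt ha) y m) :
    ∃ ξ : EnergySpace ha, y = energyEmb ha ξ ∧ ‖ξ‖ ^ 2 ≤ m := by
  have hb : ∀ z, ‖inner ℂ z y‖ ≤ √m * ‖energyProj ha z‖ := by
    intro z
    obtain ⟨x, hx, rfl⟩ := exists_of_mem_graph
      ((mem_graph_friedrichsExt ha hd hc (z := z)).2 rfl)
    refine le_of_sq_le_sq ?_ (by positivity)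
    have := hy x
    rw [hx, ← energyInv_apply, inner_energyInv] at this
    rw [mul_pow, Real.sq_sqrt hm, ← inner_self_eq_norm_sq (𝕜 := ℂ) (energyProj ha _)]
    exact this
  have hdom : y ∈ (opQ ha).adjoint.adjoint.domain := by
    rw [mem_adjoint_domain_iff]
    refine AddMonoidHomClass.continuous_of_bound _ (√m) fun x => ?_
    have := (mem_graph_adjoint_opQ ha hd hc).1 (mem_graph _ x)
    change ‖inner ℂ y ((opQ ha).adjoint x)‖ ≤ √m * ‖(x : EnergySpace ha)‖
    rw [norm_inner_symm, this]
    exact hb _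
  obtain ⟨ξ, hξ⟩ := mem_domain_iff.1 hdom
  rw [mem_graph_adjoint_adjoint_opQ ha hd hc] at hξ
  refine ⟨ξ, hξ, ?_⟩
  -- The bound |(η, ξ)| ≤ √m ‖η‖ holds on the dense range of ι*, hence at η = ξ.
  have h1 : ‖inner ℂ ξ ξ‖ ≤ √m * ‖ξ‖ := by
    refine (denseRange_energyProj ha hc).induction_on (p := fun η => ‖inner ℂ η ξ‖ ≤ √m * ‖η‖) ξ
      (isClosed_le (by fun_prop) (by fun_prop)) fun z => ?_
    rw [ContinuousLinearMap.adjoint_inner_left, ← hξ]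
    exact hb z
  rw [inner_self_eq_norm_sq_to_K] at h1
  have h2 : ‖ξ‖ * ‖ξ‖ ≤ √m * ‖ξ‖ := by simpa [pow_two] using h1
  have h3 : ‖ξ‖ ≤ √m := by
    by_cases h0 : ‖ξ‖ = 0
    · rw [h0]; positivity
    · exact le_of_mul_le_mul_right h2 (lt_of_le_of_ne (norm_nonneg _) (Ne.symm h0))
  calc ‖ξ‖ ^ 2 ≤ √m ^ 2 := by gcongr
    _ = m := Real.sq_sqrt hm

/-- Cauchy–Schwarz for T against vectors of dom a gives the bound on a dense subset of H_a;
continuity extends it. -/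
theorem le_friedrichsExt_of_isPosSymm (hd : Dense (a.domain : Set H)) (hc : HasPosLowerBound a)
    {T : H →ₗ.[ℂ] H} (hT : IsPosSymm T) (haT : a ≤ T) :
    FormLE T (friedrichsExt ha) := by
  intro y m hm hy x
  obtain ⟨ξ, rfl, hξ⟩ := exists_eq_energyEmb_of_formBound ha hd hc hm hy
  refine le_trans ?_ (mul_le_mul_of_nonneg_right hξ (hT.nonneg x))
  refine (denseRange_toEnergy ha).induction_on ξ (p := fun ξ =>
    ‖inner ℂ (T x) (energyEmb ha ξ)‖ ^ 2 ≤ ‖ξ‖ ^ 2 * (inner ℂ (T x) (x : H)).re)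
    (isClosed_le (by fun_prop) (by fun_prop)) fun x' => ?_
  rw [energyEmb_toEnergy ha hc, norm_toEnergy_sq]
  have hTx : T ⟨x', haT.1 x'.2⟩ = a x' := (haT.2 rfl).symm
  have := hT.norm_inner_sq_le x ⟨x', haT.1 x'.2⟩
  rwa [hTx] at this

end Extensions

/-! ### The form sum against the operator sum -/

section FormSums

variable {H : Type*} [NormedAddCommGroup H] [InnerProductSpace ℂ H]

theorem range_smul {a : H →ₗ.[ℂ] H} {c : ℂ} (hc : c ≠ 0) :
    LinearMap.range (c • a).toFun = LinearMap.range a.toFun := by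
  ext y
  constructor
  · rintro ⟨x, rfl⟩
    exact Submodule.smul_mem _ c ⟨x, rfl⟩
  · rintro ⟨x, rfl⟩
    refine ⟨c⁻¹ • x, ?_⟩
    change c • a (c⁻¹ • x) = a x
    rw [LinearPMap.map_smul, smul_inv_smul₀ hc]

theorem mem_graph_adjoint_opJSum {A B : H →ₗ.[ℂ] H} (hA : IsPosSymm A) (hB : IsPosSymm B)
    (hdA : Dense (A.domain : Set H)) (hdB : Dense (B.domain : Set H))
    {y : H} {w : WithLp 2 (EnergySpace hA × EnergySpace hB)} :
    (y, w) ∈ (opJSum hA hB).adjoint.graph ↔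
      (∀ x : A.domain, inner ℂ (A x) y = inner ℂ (toEnergy hA x) w.fst) ∧
        ∀ x : B.domain, inner ℂ (B x) y = inner ℂ (toEnergy hB x) w.snd := by
  have hf : DenseRange ((WithLp.linearEquiv 2 ℂ (EnergySpace hA × EnergySpace hB)).symm.toLinearMap ∘ₗ
        (toEnergy hA).prodMap (toEnergy hB)) := by
    refine DenseRange.comp (g := (WithLp.linearEquiv 2 ℂ (EnergySpace hA × EnergySpace hB)).symm)
      (LinearEquiv.surjective _).denseRange
      ((denseRange_toEnergy hA).prodMap (denseRange_toEnergy hB)) ?_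
    exact WithLp.prod_continuous_toLp 2 _ _
  rw [opJSum, mem_graph_adjoint_range hf]
  · constructor
    · intro h
      constructor
      · intro x
        simpa [WithLp.prod_inner_apply] using h (x, 0)
      · intro x
        simpa [WithLp.prod_inner_apply] using h (0, x)
    · rintro ⟨h1, h2⟩ ⟨x, x'⟩
      simp [WithLp.prod_inner_apply, ← h1, ← h2]
  · rintro ⟨x, x'⟩ h
    have h' : (toEnergy hA x, toEnergy hB x') = 0 :=
      (WithLp.linearEquiv 2 ℂ (EnergySpace hA × EnergySpace hB)).symm.map_eq_zero_iff.1 h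
    obtain ⟨h1, h2⟩ := Prod.mk.inj h'
    have e1 : A.toFun x = 0 := eq_zero_of_toEnergy_eq_zero hA hdA h1
    have e2 : B.toFun x' = 0 := eq_zero_of_toEnergy_eq_zero hB hdB h2
    rw [LinearMap.coprod_apply, e1, e2, add_zero]

variable [CompleteSpace H] {a : H →ₗ.[ℂ] H} (ha : IsPosSymm a)

/-- The energy space of an extension `A` of `a` whose form is given by the embedded energy space of
`a` is that of `a`. -/
theorem exists_energySpace_equiv {A : H →ₗ.[ℂ] H} (hA : IsPosSymm A) (hc : HasPosLowerBound a)
    (haA : a ≤ A)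
    (h : ∀ x : A.domain, ‖energyProj ha (A x)‖ ^ 2 = (inner ℂ (A x) (x : H)).re) :
    ∃ V : EnergySpace hA ≃ₗᵢ[ℂ] EnergySpace ha,
      ∀ x, V (toEnergy hA x) = energyProj ha (A x) := by
  -- For x in dom a the vector ι*(A x) is `toEnergy ha x`, and these are dense.
  have hd2 : DenseRange ((energyProj ha).toLinearMap ∘ₗ A.toFun) := by
    refine (denseRange_toEnergy ha).mono ?_
    rintro _ ⟨x, rfl⟩
    refine ⟨⟨x, haA.1 x.2⟩, ?_⟩
    have hx : A ⟨x, haA.1 x.2⟩ = a x := (haA.2 rfl).symm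
    rw [← energyProj_apply ha hc, ← hx]
    rfl
  have hn : ∀ x, ‖((energyProj ha).toLinearMap ∘ₗ A.toFun) (LinearEquiv.refl ℂ A.domain x)‖ =
      ‖toEnergy hA x‖ := by
    intro x
    refine (sq_eq_sq₀ (norm_nonneg _) (norm_nonneg _)).1 ?_
    rw [norm_toEnergy_sq]
    exact h x
  exact ⟨(LinearEquiv.refl ℂ A.domain).extendOfIsometry (toEnergy hA)
      ((energyProj ha).toLinearMap ∘ₗ A.toFun) (denseRange_toEnergy hA) hd2 hn,
    fun x => LinearEquiv.extendOfIsometry_eq _ _ _ (denseRange_toEnergy hA) hd2 hn x⟩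

theorem formSum_kreinExt_friedrichsExt (hd : Dense (a.domain : Set H)) (hc : HasPosLowerBound a)
    (hr : IsClosed (LinearMap.range a.toFun : Set H)) :
    formSum (kreinExt_isPosSymm ha) (friedrichsExt_isPosSymm ha) = (2 : ℂ) • friedrichsExt ha := by
  have hK := le_kreinExt ha hd hc hr
  have hF := le_friedrichsExt ha hd hc
  obtain ⟨V, hV⟩ := exists_energySpace_equiv ha (kreinExt_isPosSymm ha) hc hK (by
    intro x
    obtain ⟨x₀, n, hn, h1, h2⟩ := (mem_graph_kreinExt ha hd hc hr).1 (mem_graph _ x)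
    have hn0 : inner ℂ (a x₀) n = 0 := (Submodule.mem_orthogonal _ _).1 hn _ ⟨x₀, rfl⟩
    rw [h1, h2, energyProj_apply ha hc, norm_toEnergy_sq, inner_add_right, hn0, add_zero])
  obtain ⟨W, hW⟩ := exists_energySpace_equiv ha (friedrichsExt_isPosSymm ha) hc hF (by
    intro x
    have h1 := (mem_graph_friedrichsExt ha hd hc).1 (mem_graph _ x)
    rw [h1, ← energyInv_apply, inner_energyInv, ← inner_self_eq_norm_sq (𝕜 := ℂ)]
    rfl)
  have hadj : ∀ y w, (y, w) ∈ (opJSum (kreinExt_isPosSymm ha)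
      (friedrichsExt_isPosSymm ha)).adjoint.graph ↔
      ∃ ζ, y = energyEmb ha ζ ∧ w = WithLp.toLp 2 (V.symm ζ, W.symm ζ) := by
    intro y w
    rw [mem_graph_adjoint_opJSum _ _ (hd.mono hK.1) (hd.mono hF.1)]
    simp only [← V.inner_map_map, ← W.inner_map_map, hV, hW]
    constructor
    · rintro ⟨h1, h2⟩
      -- The values of a_F exhaust H, so its condition alone determines y; the a_K condition on dom
      -- a then forces equal components.
      have hy : y = energyEmb ha (W w.snd) := by
        refine ext_inner_left ℂ fun z => ?_
        obtain ⟨x, -, rfl⟩ := exists_of_mem_graph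
          ((mem_graph_friedrichsExt ha hd hc (z := z)).2 rfl)
        rw [h2, ContinuousLinearMap.adjoint_inner_left]
      have hVW : V w.fst = W w.snd := by
        refine ext_inner_left ℂ fun ζ => ?_
        refine (denseRange_toEnergy ha).induction_on ζ
          (isClosed_eq (by fun_prop) (by fun_prop)) fun x => ?_
        have h3 := h1 ⟨x, hK.1 x.2⟩
        have hx : kreinExt ha ⟨x, hK.1 x.2⟩ = a x := (hK.2 rfl).symm
        rw [hx, energyProj_apply ha hc] at h3
        rw [← h3, hy, inner_energyEmb ha hc]
      refine ⟨W w.snd, hy, ?_⟩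
      rw [W.symm_apply_apply, ← hVW, V.symm_apply_apply]
      rfl
    · rintro ⟨ζ, rfl, rfl⟩
      constructor
      · intro x
        simp [ContinuousLinearMap.adjoint_inner_left]
      · intro x
        simp [ContinuousLinearMap.adjoint_inner_left]
  have hdense : Dense ((opJSum (kreinExt_isPosSymm ha)
      (friedrichsExt_isPosSymm ha)).adjoint.domain : Set H) := by
    refine hd.mono fun x hx => ?_
    exact mem_domain_of_mem_graph ((hadj _ _).2
      ⟨toEnergy ha ⟨x, hx⟩, (energyEmb_toEnergy ha hc ⟨x, hx⟩).symm, rfl⟩)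
  refine eq_of_mem_graph_iff fun y u => ?_
  rw [mem_graph_smul two_ne_zero, mem_graph_friedrichsExt ha hd hc, formSum, mem_graph_opMul]
  simp only [mem_graph_adjoint' hdense, hadj]
  -- The factor 2 comes from the two equal components of J*ιζ.
  have key : ∀ ζ : EnergySpace ha, (∀ η : EnergySpace ha,
      inner ℂ (WithLp.toLp 2 (V.symm η, W.symm η)) (WithLp.toLp 2 (V.symm ζ, W.symm ζ)) =
        inner ℂ (energyEmb ha η) u) ↔ ζ = energyProj ha ((2 : ℂ)⁻¹ • u) := by
    intro ζ
    have h1 : ∀ η : EnergySpace ha,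
      inner ℂ (WithLp.toLp 2 (V.symm η, W.symm η)) (WithLp.toLp 2 (V.symm ζ, W.symm ζ)) =
        inner ℂ η ((2 : ℂ) • ζ) := by
      intro η
      simp only [WithLp.prod_inner_apply, LinearIsometryEquiv.inner_map_map, inner_smul_right]
      ring
    simp only [h1, ← ContinuousLinearMap.adjoint_inner_right]
    rw [_root_.map_smul, eq_inv_smul_iff₀ two_ne_zero]
    exact ⟨fun h => ext_inner_left ℂ h, fun h η => by rw [h]⟩
  constructor
  · rintro ⟨_, ⟨ζ, rfl, rfl⟩, h⟩
    rw [← (key ζ).1 fun η => h _ _ ⟨η, rfl, rfl⟩]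
  · intro h
    refine ⟨_, ⟨_, h, rfl⟩, ?_⟩
    rintro _ _ ⟨η, rfl, rfl⟩
    exact (key _).2 rfl η

theorem kreinExt_add_friedrichsExt (hd : Dense (a.domain : Set H)) (hc : HasPosLowerBound a)
    (hr : IsClosed (LinearMap.range a.toFun : Set H)) :
    kreinExt ha + friedrichsExt ha = (2 : ℂ) • a := by
  have hK := le_kreinExt ha hd hc hr
  have hF := le_friedrichsExt ha hd hc
  have hle : a.domain ≤ (kreinExt ha + friedrichsExt ha).domain := fun x hx => ⟨hK.1 hx, hF.1 hx⟩
  refine (eq_of_le_of_domain_eq (f := (2 : ℂ) • a) ⟨hle, ?_⟩ ?_).symm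
  · rintro x ⟨y, hy⟩ hxy
    obtain rfl : (x : H) = y := hxy
    have h1 : kreinExt ha ⟨x, hK.1 x.2⟩ = a x := (hK.2 rfl).symm
    have h2 : friedrichsExt ha ⟨x, hF.1 x.2⟩ = a x := (hF.2 rfl).symm
    rw [LinearPMap.add_apply, LinearPMap.smul_apply, two_smul]
    exact congrArg₂ (· + ·) h1.symm h2.symm
  · refine le_antisymm hle ?_
    intro x hx
    have hxK : x ∈ (kreinExt ha).domain := hx.1
    have hxF : x ∈ (friedrichsExt ha).domain := hx.2
    obtain ⟨x₀, n, hn, h1, -⟩ := (mem_graph_kreinExt ha hd hc hr).1 (mem_graph _ ⟨x, hxK⟩)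
    have h2 := (mem_graph_friedrichsExt ha hd hc).1 (mem_graph _ ⟨x, hxF⟩)
    have hn0 : n = 0 := by
      refine eq_zero_of_mem_orthogonal_of_eq_energyInv ha hd hc hn
        (z := friedrichsExt ha ⟨x, hxF⟩ - a x₀) ?_
      rw [_root_.map_sub, energyInv_comp ha hc, energyInv_apply, ← h2]
      exact eq_sub_of_add_eq' h1.symm
    have h3 : x = x₀ := by simpa [hn0] using h1
    rw [h3]
    exact x₀.2

/-- Doubling `a` leaves dom a and ran a unchanged. The variable `b` allows any proof of positivity,
in particular that of the sum. -/
theorem kreinExt_two_smul (hd : Dense (a.domain : Set H)) (hc : HasPosLowerBound a)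
    (hr : IsClosed (LinearMap.range a.toFun : Set H)) {b : H →ₗ.[ℂ] H} (hb : IsPosSymm b)
    (hba : b = (2 : ℂ) • a) : kreinExt hb = (2 : ℂ) • kreinExt ha := by
  subst hba
  have hc' : HasPosLowerBound ((2 : ℂ) • a) := by
    obtain ⟨c, hc0, hc⟩ := hc
    refine ⟨c, hc0, fun x => ?_⟩
    have h1 := hc x
    have h2 := ha.nonneg x
    rw [LinearPMap.smul_apply, two_smul, inner_add_left, Complex.add_re]
    exact h1.trans (le_add_of_nonneg_left h2)
  have hrg := range_smul (a := a) two_ne_zero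
  refine eq_of_mem_graph_iff fun y z => ?_
  rw [mem_graph_smul two_ne_zero, mem_graph_kreinExt hb hd hc' (by rw [hrg]; exact hr),
    mem_graph_kreinExt ha hd hc hr, hrg]
  constructor
  · rintro ⟨x, n, hn, rfl, rfl⟩
    exact ⟨x, n, hn, rfl, by rw [LinearPMap.smul_apply, inv_smul_smul₀ two_ne_zero]⟩
  · rintro ⟨x, n, hn, rfl, h⟩
    exact ⟨x, n, hn, rfl, by rw [LinearPMap.smul_apply, ← h, smul_inv_smul₀ two_ne_zero]⟩

theorem two_smul_friedrichsExt_ne (hd : Dense (a.domain : Set H)) (hc : HasPosLowerBound a)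
    (hr : IsClosed (LinearMap.range a.toFun : Set H)) {n : H}
    (hn : n ∈ (LinearMap.range a.toFun)ᗮ) (hn0 : n ≠ 0) :
    (2 : ℂ) • friedrichsExt ha ≠ (2 : ℂ) • kreinExt ha := by
  intro h
  have h1 : (n, (0 : H)) ∈ ((2 : ℂ) • kreinExt ha).graph := by
    rw [mem_graph_smul two_ne_zero, smul_zero, mem_graph_kreinExt ha hd hc hr]
    exact ⟨0, n, hn, by simp, by simp⟩
  rw [← h, mem_graph_smul two_ne_zero, smul_zero, mem_graph_friedrichsExt ha hd hc] at h1
  exact hn0 (by simpa using h1)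

theorem krein_friedrichs_formSum (hd : Dense (a.domain : Set H)) (hcl : a.IsClosed)
    (hc : HasPosLowerBound a) (hns : ¬ IsSelfAdjoint a) :
    0 < Module.rank ℂ (LinearMap.ker a.adjoint.toFun) ∧
      {T : H →ₗ.[ℂ] H | IsSelfAdjoint T ∧ a ≤ T}.Infinite ∧
      (∀ T : H →ₗ.[ℂ] H, IsSelfAdjoint T → a ≤ T → T ≤ a.adjoint) ∧
      IsPosSelfAdjoint (kreinExt ha) ∧ a ≤ kreinExt ha ∧
      IsPosSelfAdjoint (friedrichsExt ha) ∧ a ≤ friedrichsExt ha ∧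
      (∀ T : H →ₗ.[ℂ] H, IsPosSelfAdjoint T → a ≤ T →
        FormLE (kreinExt ha) T ∧ FormLE T (friedrichsExt ha)) ∧
      Dense ((kreinExt ha + friedrichsExt ha).domain : Set H) ∧
      formSum (kreinExt_isPosSymm ha) (friedrichsExt_isPosSymm ha) =
        (2 : ℂ) • friedrichsExt ha ∧
      kreinExt ((kreinExt_isPosSymm ha).add (friedrichsExt_isPosSymm ha)) =
        (2 : ℂ) • kreinExt ha ∧
      formSum (kreinExt_isPosSymm ha) (friedrichsExt_isPosSymm ha) ≠
        kreinExt ((kreinExt_isPosSymm ha).add (friedrichsExt_isPosSymm ha)) := by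
  have hr := hc.isClosed_range hcl
  obtain ⟨n, hn, hn0⟩ := exists_ne_zero_mem_orthogonal_range ha hd hr hns
  have hsum := formSum_kreinExt_friedrichsExt ha hd hc hr
  have hadd := kreinExt_add_friedrichsExt ha hd hc hr
  have hkr := kreinExt_two_smul ha hd hc hr
    ((kreinExt_isPosSymm ha).add (friedrichsExt_isPosSymm ha)) hadd
  refine ⟨rank_ker_adjoint_pos hd hn hn0, infinite_selfAdjoint_extensions ha hd hc hn hn0,
    fun T hT haT => le_adjoint_of_isSelfAdjoint hd hT haT,
    kreinExt_isPosSelfAdjoint ha hd hc hr, le_kreinExt ha hd hc hr,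
    friedrichsExt_isPosSelfAdjoint ha hd hc, le_friedrichsExt ha hd hc,
    fun T hT haT => ⟨kreinExt_le ha hd hc hr haT,
      le_friedrichsExt_of_isPosSymm ha hd hc hT.1 haT⟩, ?_, hsum, hkr, ?_⟩
  · rw [hadd]
    exact hd
  · rw [hsum, hkr]
    exact two_smul_friedrichsExt_ne ha hd hc hr hn hn0

end FormSums

/-! ### A closed, non-selfadjoint operator with positive lower bound -/

section Restriction

variable {H : Type*} [NormedAddCommGroup H] [InnerProductSpace ℂ H]

/-- The restriction of the inverse of `K ^ 2` to the preimage of the orthogonal complement of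
`n`. -/
noncomputable def restrictedInverse (K : H →L[ℂ] H) (n : H) : H →ₗ.[ℂ] H :=
  (LinearMap.range (((K.comp K).toLinearMap ∘ₗ (ℂ ∙ n)ᗮ.subtype).prod
    (ℂ ∙ n)ᗮ.subtype)).toLinearPMap

variable {K : H →L[ℂ] H} {n : H}

theorem mem_graph_restrictedInverse
    (hK : ∀ z, K z = 0 → z = 0) {x z : H} :
    (x, z) ∈ (restrictedInverse K n).graph ↔ x = K (K z) ∧ inner ℂ n z = 0 := by
  rw [restrictedInverse, graph_toLinearPMap_range fun v hv => hK _ (hK _ hv)]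
  constructor
  · rintro ⟨w, hw⟩
    obtain ⟨rfl, rfl⟩ := Prod.mk.inj hw
    exact ⟨rfl, Submodule.mem_orthogonal_singleton_iff_inner_right.1 w.2⟩
  · rintro ⟨rfl, hz⟩
    exact ⟨⟨z, Submodule.mem_orthogonal_singleton_iff_inner_right.2 hz⟩, rfl⟩

theorem isPosSymm_restrictedInverse
    (hs : ∀ x y, inner ℂ (K x) y = inner ℂ x (K y))
    (hK : ∀ z, K z = 0 → z = 0) : IsPosSymm (restrictedInverse K n) := by
  refine isPosSymm_of_repr (fun x => K (restrictedInverse K n x)) fun x y => ?_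
  rw [((mem_graph_restrictedInverse hK).1 (mem_graph _ y)).1, ← hs]

theorem isClosed_restrictedInverse (hK : ∀ z, K z = 0 → z = 0) :
    (restrictedInverse K n).IsClosed := by
  have h : ((restrictedInverse K n).graph : Set (H × H)) =
      {p | p.1 = K (K p.2)} ∩ {p | inner ℂ n p.2 = 0} :=
    Set.ext fun p => mem_graph_restrictedInverse hK
  rw [LinearPMap.IsClosed, h]
  exact (isClosed_eq (by fun_prop) (by fun_prop)).inter (isClosed_eq (by fun_prop) (by fun_prop))

theorem hasPosLowerBound_restrictedInverse
    (hs : ∀ x y, inner ℂ (K x) y = inner ℂ x (K y))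
    (hK : ∀ z, K z = 0 → z = 0) : HasPosLowerBound (restrictedInverse K n) := by
  -- With x = K(K z) the form is ‖K z‖² and ‖x‖² ≤ ‖K‖²‖K z‖²; the 1 covers K = 0.
  refine ⟨(‖K‖ ^ 2 + 1)⁻¹, by positivity, fun x => ?_⟩
  have h := ((mem_graph_restrictedInverse hK).1 (mem_graph _ x)).1
  set z := restrictedInverse K n x
  have h2 : (inner ℂ z (x : H)).re = ‖K z‖ ^ 2 := by
    rw [h, ← hs, ← inner_self_eq_norm_sq (𝕜 := ℂ)]
    rfl
  rw [h2, h, inv_mul_le_iff₀ (by positivity)]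
  calc ‖K (K z)‖ ^ 2 ≤ (‖K‖ * ‖K z‖) ^ 2 := by gcongr; exact K.le_opNorm _
    _ ≤ (‖K‖ ^ 2 + 1) * ‖K z‖ ^ 2 := by rw [mul_pow]; gcongr; linarith

variable [CompleteSpace H]

/-- If w is orthogonal to K²(nᗮ), then K²w is a multiple of n; as n is not in ran K, the multiple is
0 and w = 0. -/
theorem dense_domain_restrictedInverse
    (hs : ∀ x y, inner ℂ (K x) y = inner ℂ x (K y))
    (hK : ∀ z, K z = 0 → z = 0)
    (hn : n ∉ Set.range K) : Dense ((restrictedInverse K n).domain : Set H) := by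
  refine dense_of_forall_inner_eq_zero fun w hw => ?_
  have h1 : K (K w) ∈ (ℂ ∙ n)ᗮᗮ := by
    rw [Submodule.mem_orthogonal]
    intro u hu
    rw [← hs, ← hs]
    exact hw _ (mem_domain_of_mem_graph ((mem_graph_restrictedInverse hK).2
      ⟨rfl, Submodule.mem_orthogonal_singleton_iff_inner_right.1 hu⟩))
  rw [Submodule.orthogonal_orthogonal, Submodule.mem_span_singleton] at h1
  obtain ⟨c, hc⟩ := h1
  by_cases h0 : c = 0
  · rw [h0, zero_smul] at hc
    exact hK _ (hK _ hc.symm)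
  · refine absurd ⟨c⁻¹ • K w, ?_⟩ hn
    rw [_root_.map_smul, ← hc, inv_smul_smul₀ h0]

/-- The adjoint kills n, while the operator itself is injective and n ≠ 0. -/
theorem not_isSelfAdjoint_restrictedInverse
    (hs : ∀ x y, inner ℂ (K x) y = inner ℂ x (K y))
    (hK : ∀ z, K z = 0 → z = 0)
    (hn : n ∉ Set.range K) : ¬ IsSelfAdjoint (restrictedInverse K n) := by
  intro h
  have h1 : (n, (0 : H)) ∈ (restrictedInverse K n).adjoint.graph := by
    rw [mem_graph_adjoint' (dense_domain_restrictedInverse hs hK hn)]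
    intro u v huv
    rw [inner_zero_right, inner_eq_zero_symm]
    exact ((mem_graph_restrictedInverse hK).1 huv).2
  rw [LinearPMap.isSelfAdjoint_def.1 h, mem_graph_restrictedInverse hK] at h1
  exact hn ⟨0, by simpa using h1.1.symm⟩

end Restriction

/-! ### The concrete example in ℓ² -/

section Diagonal

theorem norm_div_succ_le (k : ℕ) (z : ℂ) : ‖z / ((k : ℂ) + 1)‖ ≤ ‖z‖ := by
  rw [norm_div]
  refine div_le_self (norm_nonneg _) ?_
  have : ‖((k : ℂ) + 1)‖ = (k : ℝ) + 1 := by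
    exact_mod_cast Complex.norm_natCast (k + 1)
  rw [this]
  linarith [Nat.cast_nonneg (α := ℝ) k]

/-- The diagonal operator with eigenvalues `1 / (k + 1)` in `ℓ²`. -/
noncomputable def harmonicDiag : lp (fun _ : ℕ => ℂ) 2 →L[ℂ] lp (fun _ : ℕ => ℂ) 2 :=
  LinearMap.mkContinuous
    { toFun := fun f => ⟨fun k => f k / ((k : ℂ) + 1),
        (lp.memℓp f).mono' fun k => norm_div_succ_le k (f k)⟩
      map_add' := fun f g => by ext k; exact add_div _ _ _
      map_smul' := fun c f => by ext k; simp [mul_div_assoc] }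
    1 fun f => by
      rw [one_mul]
      exact lp.norm_mono two_ne_zero fun k => norm_div_succ_le k (f k)

theorem harmonicDiag_apply (f : lp (fun _ : ℕ => ℂ) 2) (k : ℕ) :
    harmonicDiag f k = f k / ((k : ℂ) + 1) := rfl

theorem harmonicDiag_inner (f g : lp (fun _ : ℕ => ℂ) 2) :
    inner ℂ (harmonicDiag f) g = inner ℂ f (harmonicDiag g) := by
  rw [lp.inner_eq_tsum, lp.inner_eq_tsum]
  refine tsum_congr fun k => ?_
  simp only [harmonicDiag_apply, RCLike.inner_apply, map_div₀, _root_.map_add, map_one,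
     Complex.conj_natCast]
  ring

theorem eq_zero_of_harmonicDiag_eq_zero (f : lp (fun _ : ℕ => ℂ) 2) (h : harmonicDiag f = 0) :
    f = 0 := by
  ext k
  have h1 : f k / ((k : ℂ) + 1) = 0 := by
    rw [← harmonicDiag_apply, h]
    rfl
  exact (div_eq_zero_iff.1 h1).resolve_right (Nat.cast_add_one_ne_zero k)

/-- The sequence 1/(k + 1) is square summable, but its only possible preimage is the constant
sequence 1. -/
theorem exists_notMem_range_harmonicDiag : ∃ n, n ∉ Set.range harmonicDiag := by
  have hm : Memℓp (fun k : ℕ => 1 / ((k : ℂ) + 1)) 2 := by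
    refine memℓp_gen ?_
    have : Summable fun k : ℕ => 1 / ((k + 1 : ℕ) : ℝ) ^ 2 :=
      (summable_nat_add_iff 1).2 (Real.summable_one_div_nat_pow.2 one_lt_two)
    refine this.congr fun k => ?_
    have hk : ‖((k : ℂ) + 1)‖ = ((k + 1 : ℕ) : ℝ) := by
      exact_mod_cast Complex.norm_natCast (k + 1)
    rw [norm_div, hk]
    simp
  refine ⟨⟨_, hm⟩, ?_⟩
  rintro ⟨f, hf⟩
  have h1 : ∀ k, f k = 1 := by
    intro k
    have h2 : f k / ((k : ℂ) + 1) = 1 / ((k : ℂ) + 1) := by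
      rw [← harmonicDiag_apply, hf]
    exact (div_left_inj' (Nat.cast_add_one_ne_zero k)).1 h2
  have h3 := (lp.memℓp f).summable (by simp)
  simp only [h1, norm_one, Real.one_rpow] at h3
  exact one_ne_zero ((summable_const_iff (1 : ℝ)).1 h3)

end Diagonal

theorem exists_formSum_ne_kreinExt_add :
    ∃ (H : Type) (_ : NormedAddCommGroup H) (_ : InnerProductSpace ℂ H) (_ : CompleteSpace H)
      (A B : H →ₗ.[ℂ] H) (hA : IsPosSymm A) (hB : IsPosSymm B),
      IsSelfAdjoint A ∧ IsSelfAdjoint B ∧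
      Dense ((A.domain : Set H) ∩ (B.domain : Set H)) ∧
      formSum hA hB ≠ kreinExt (hA.add hB) := by
  obtain ⟨n, hn⟩ := exists_notMem_range_harmonicDiag
  have hs := harmonicDiag_inner
  have hK := eq_zero_of_harmonicDiag_eq_zero
  have ha : IsPosSymm (restrictedInverse harmonicDiag n) := isPosSymm_restrictedInverse hs hK
  obtain ⟨-, -, -, hA, -, hB, -, -, hd, -, -, hne⟩ := krein_friedrichs_formSum ha
    (dense_domain_restrictedInverse hs hK hn) (isClosed_restrictedInverse hK)
    (hasPosLowerBound_restrictedInverse hs hK) (not_isSelfAdjoint_restrictedInverse hs hK hn)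
  exact ⟨_, _, _, inferInstance, _, _, _, _, hA.2, hB.2, hd, hne⟩

end FormSum

theorem mainTheorem9 :
    (∀ (H : Type*) [NormedAddCommGroup H] [InnerProductSpace ℂ H] [CompleteSpace H]
      (a : H →ₗ.[ℂ] H) (ha : FormSum.IsPosSymm a),
      Dense (a.domain : Set H) → a.IsClosed →
      (∃ c : ℝ, 0 < c ∧ ∀ x : a.domain, c * ‖(x : H)‖ ^ 2 ≤ (inner ℂ (a x) (x : H)).re) →
      ¬ IsSelfAdjoint a →
      -- the deficiency index is positive, and there are infinitely many selfadjoint extensions,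
      -- all of them restrictions of the adjoint
      0 < Module.rank ℂ (LinearMap.ker a.adjoint.toFun) ∧
      {T : H →ₗ.[ℂ] H | IsSelfAdjoint T ∧ a ≤ T}.Infinite ∧
      (∀ T : H →ₗ.[ℂ] H, IsSelfAdjoint T → a ≤ T → T ≤ a.adjoint) ∧
      -- the two extensions are positive selfadjoint extensions, and extremal among these
      FormSum.IsPosSelfAdjoint (FormSum.kreinExt ha) ∧ a ≤ FormSum.kreinExt ha ∧
      FormSum.IsPosSelfAdjoint (FormSum.friedrichsExt ha) ∧ a ≤ FormSum.friedrichsExt ha ∧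
      (∀ T : H →ₗ.[ℂ] H, FormSum.IsPosSelfAdjoint T → a ≤ T →
        FormSum.FormLE (FormSum.kreinExt ha) T ∧ FormSum.FormLE T (FormSum.friedrichsExt ha)) ∧
      -- the operator sum has a dense domain
      Dense ((FormSum.kreinExt ha + FormSum.friedrichsExt ha).domain : Set H) ∧
      -- the form sum and the extension of the operator sum, which differ
      FormSum.formSum (FormSum.kreinExt_isPosSymm ha) (FormSum.friedrichsExt_isPosSymm ha) =
        (2 : ℂ) • FormSum.friedrichsExt ha ∧
      FormSum.kreinExt
          ((FormSum.kreinExt_isPosSymm ha).add (FormSum.friedrichsExt_isPosSymm ha)) =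
        (2 : ℂ) • FormSum.kreinExt ha ∧
      FormSum.formSum (FormSum.kreinExt_isPosSymm ha) (FormSum.friedrichsExt_isPosSymm ha) ≠
        FormSum.kreinExt
          ((FormSum.kreinExt_isPosSymm ha).add (FormSum.friedrichsExt_isPosSymm ha))) ∧
    -- in general `A ∔ B ≠ (A + B)_K`, even if `dom A ∩ dom B` is dense
    ∃ (H : Type) (_ : NormedAddCommGroup H) (_ : InnerProductSpace ℂ H) (_ : CompleteSpace H)
      (A B : H →ₗ.[ℂ] H) (hA : FormSum.IsPosSymm A) (hB : FormSum.IsPosSymm B),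
      IsSelfAdjoint A ∧ IsSelfAdjoint B ∧
      Dense ((A.domain : Set H) ∩ (B.domain : Set H)) ∧
      FormSum.formSum hA hB ≠ FormSum.kreinExt (hA.add hB) := by
  refine ⟨?_, FormSum.exists_formSum_ne_kreinExt_add⟩
  intro H _ _ _ a ha hd hcl hc hns
  exact FormSum.krein_friedrichs_formSum ha hd hcl hc hns
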